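/- Let $\mathcal W,\mathcal X,\hat{\mathcal W}$ be measurable spaces, $\mathcal P_W$ a probability measure on $\mathcal W$, $(\mathcal P_{X|W=w})_{w\in\mathcal W}$ a Markov kernel from $\mathcal W$ to $\mathcal X$, and $\ell:\mathcal W\times\hat{\mathcal W}\to[0,\infty)$ a measurable loss. Let $\mathcal P_{WX}$ be the induced joint law of $(W,X)$. For a measurable estimator $\phi:\mathcal X\to\hat{\mathcal W}$ put $\hat W=\phi(X)$, let $\mathcal P_{W\hat W}$ be the law of $(W,\hat W)$ and $\mathcal P_{\hat W}$ the law of $\hat W$. The Bayes risk is $R_B=\inf_\phi \mathcal P_{W\hat W}(\ell)$, where $\mu(f)=\int f\,d\mu$ and the infimum is over all measurable $\phi$. Write $\mu^{s}(f)=\left(\int f\,d\mu\right)^{s}$, and let $\frac{d\mathcal P_{W\hat W}}{d\mathcal P_W\mathcal P_{\hat W}}$ be the Radon–Nikodym derivative with respect to the product of the marginals (the density of the absolutely continuous part, if $\mathcal P_{W\hat W}$ is not absolutely continuous). Conventions: $0^{s}=\infty$ and $\infty^{s}=0$ for $s<0$, $0\cdot\infty=0$. For $\alpha\in(0,1)$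 the Rényi divergence is $D_\alpha(P\|Q)=\frac1{\alpha-1}\log\int p^\alpha q^{1-\alpha}\,d\mu\in[0,\infty]$ ($p,q$ densities of $P,Q$ with respect to a common dominating measure $\mu$), and for a pair $(U,V)$ with joint law $\mathcal P_{UV}$, Sibson's mutual information is $I_\alpha(U,V)=\inf_{Q}D_\alpha(\mathcal P_{UV}\|\mathcal P_U\otimes Q)$, the infimum being over probability measures $Q$ on the space of $V$. 1. For every measurable $\phi$ and all real $\alpha,\alpha'<1$, $\alpha,\alpha'\neq0$, with $\frac1\alpha+\frac1\beta=1=\frac1{\alpha'}+\frac1{\beta'}$, $$\mathcal P_{W\hat W}(\ell)\ \ge\ \mathcal P_{\hat W}^{\frac1{\beta'}}\!\left(\mathcal P_W^{\frac{\beta'}{\beta}}\!\left(\ell^{\beta}\right)\right)\cdot \mathcal P_{\hat W}^{\frac1{\alpha'}}\!\left(\mathcal P_W^{\frac{\alpha'}{\alpha}}\!\left(\left(\frac{d\mathcal P_{W\hat W}}{d\mathcal P_W\mathcal P_{\hat W}}\right)^{\alpha}\right)\right).$$ 2. Let $0<\alpha<1$ and $\frac1\alpha+\frac1\beta=1$.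 For every measurable $\phi$, as $\alpha'\to1^-$ (so that $\beta'=\frac{\alpha'}{\alpha'-1}\to-\infty$) the right-hand side above converges to $$\operatorname*{ess\,inf}_{\mathcal P_{\hat W}}\left(\mathcal P_W^{\frac1\beta}\!\left(\ell(W,\hat W)^{\beta}\right)\right)\cdot\exp\!\left(\frac{\alpha-1}{\alpha}I_\alpha(W,\hat W)\right).$$ Moreover, for every measurable $\phi$, $$\mathcal P_{W\hat W}(\ell)\ \ge\ \operatorname*{ess\,inf}_{\mathcal P_{\hat W}}\left(\mathcal P_W^{\frac1\beta}\!\left(\ell(W,\hat W)^{\beta}\right)\right)\cdot\exp\!\left(\frac{\alpha-1}{\alpha}I_\alpha(W,X)\right),$$ and consequently $$R_B\ \ge\ \left(\inf_{\phi}\ \operatorname*{ess\,inf}_{\mathcal P_{\hat W}}\left(\mathcal P_W^{\frac1\beta}\!\left(\ell(W,\hat W)^{\beta}\right)\right)\right)\cdot\exp\!\left(\frac{\alpha-1}{\alpha}I_\alpha(W,X)\right).$$ -/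

import Mathlib

open MeasureTheory ProbabilityTheory Filter Topology
open scoped ENNReal NNReal

noncomputable section

namespace BayesFramework

/-- The law of `(W, Ŵ)`, where `W ∼ PW`, `X ∼ K w` given `W = w`, and `Ŵ = φ X`. -/
def estimatorLaw {𝒲 𝒳 𝒱 : Type*} [MeasurableSpace 𝒲] [MeasurableSpace 𝒳] [MeasurableSpace 𝒱]
    (PW : Measure 𝒲) (K : Kernel 𝒲 𝒳) (φ : 𝒳 → 𝒱) : Measure (𝒲 × 𝒱) :=
  (PW ⊗ₘ K).map (fun z => (z.1, φ z.2))

/-- The expected loss of the (deterministic) estimator `φ`. -/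
def expectedLoss {𝒲 𝒳 𝒱 : Type*} [MeasurableSpace 𝒲] [MeasurableSpace 𝒳] [MeasurableSpace 𝒱]
    (PW : Measure 𝒲) (K : Kernel 𝒲 𝒳) (ℓ : 𝒲 → 𝒱 → ℝ≥0) (φ : 𝒳 → 𝒱) : ℝ≥0∞ :=
  ∫⁻ z, (ℓ z.1 z.2 : ℝ≥0∞) ∂(estimatorLaw PW K φ)

/-- The Bayes risk: the infimum of the expected loss over all measurable estimators `φ : 𝒳 → 𝒱`. -/
def bayesRisk {𝒲 𝒳 𝒱 : Type*} [MeasurableSpace 𝒲] [MeasurableSpace 𝒳] [MeasurableSpace 𝒱]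
    (PW : Measure 𝒲) (K : Kernel 𝒲 𝒳) (ℓ : 𝒲 → 𝒱 → ℝ≥0) : ℝ≥0∞ :=
  ⨅ (φ : 𝒳 → 𝒱) (_ : Measurable φ), expectedLoss PW K ℓ φ

/-- The Rényi divergence of order `α`,
`D_α(P‖Q) = (α - 1)⁻¹ log ∫ p ^ α q ^ (1 - α) dμ`, with the dominating measure `μ = P + Q` and
`p`, `q` the densities of `P`, `Q` with respect to `μ`. The value is an extended real number. -/
def renyiDiv {Ω : Type*} [MeasurableSpace Ω] (α : ℝ) (P Q : Measure Ω) : EReal :=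
  (((α - 1)⁻¹ : ℝ) : EReal) *
    ENNReal.log (∫⁻ x, (P.rnDeriv (P + Q) x) ^ α * (Q.rnDeriv (P + Q) x) ^ (1 - α) ∂(P + Q))

/-- Sibson's mutual information of order `α` of a pair `(X, Y)` with joint law `P`:
the infimum over probability measures `Q` on the second factor of `D_α(P ‖ P_X ⊗ Q)`. -/
def sibsonInfo {𝒳 𝒴 : Type*} [MeasurableSpace 𝒳] [MeasurableSpace 𝒴] (α : ℝ)
    (P : Measure (𝒳 × 𝒴)) : EReal :=
  ⨅ Q : ProbabilityMeasure 𝒴, renyiDiv α P (P.fst.prod (Q : Measure 𝒴))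

/-- The nested (pseudo-)norm `(∫ (∫ g(w, v) ^ p μ(dw)) ^ (p' / p) ν(dv)) ^ (1 / p')`, with the
conventions `0 ^ s = ∞` and `∞ ^ s = 0` for `s < 0`. -/
def nestedNorm {𝒲 𝒱 : Type*} [MeasurableSpace 𝒲] [MeasurableSpace 𝒱]
    (μ : Measure 𝒲) (ν : Measure 𝒱) (p p' : ℝ) (g : 𝒲 → 𝒱 → ℝ≥0∞) : ℝ≥0∞ :=
  (∫⁻ v, (∫⁻ w, g w v ^ p ∂μ) ^ (p' / p) ∂ν) ^ (1 / p')

/-- The right-hand side of the reverse Hölder bound for a joint law `P` on `𝒲 × 𝒱` and a loss `ℓ`: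
the nested norm of `ℓ` with exponents `(β, β')` times the nested norm of the density of `P` with
respect to the product of its marginals, with exponents `(α, α')`. -/
def reverseHolderBound {𝒲 𝒱 : Type*} [MeasurableSpace 𝒲] [MeasurableSpace 𝒱]
    (P : Measure (𝒲 × 𝒱)) (ℓ : 𝒲 → 𝒱 → ℝ≥0) (α β α' β' : ℝ) : ℝ≥0∞ :=
  nestedNorm P.fst P.snd β β' (fun w v => (ℓ w v : ℝ≥0∞)) *
    nestedNorm P.fst P.snd α α' (fun w v => P.rnDeriv (P.fst.prod P.snd) (w, v))

/-- `ess inf` over `v ∼ ν` of `(∫ ℓ(w, v) ^ β μ(dw)) ^ (1 / β)`. -/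
def essInfNorm {𝒲 𝒱 : Type*} [MeasurableSpace 𝒲] [MeasurableSpace 𝒱]
    (μ : Measure 𝒲) (ν : Measure 𝒱) (β : ℝ) (ℓ : 𝒲 → 𝒱 → ℝ≥0) : ℝ≥0∞ :=
  essInf (fun v => (∫⁻ w, (ℓ w v : ℝ≥0∞) ^ β ∂μ) ^ (1 / β)) ν

end BayesFramework

end

/-!
The reverse Hölder inequality `‖g‖_β ‖f‖_α ≤ ∫ g f` (`α < 1`, conjugate exponents), applied with
`f` the density of the joint law and `g` the loss, first in `w` and then in `v`, gives the
nested-norm bound. As `α' → 1⁻` the outer norm of the loss has exponent tending to `-∞` and tends to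
an essential infimum, while the outer norm of the density tends to
`J = ∫ v, (∫ w, f (w, v) ^ α) ^ (1 / α)`. By Hölder, with equality at the `Q` whose density is
proportional to `(∫ w, f (w, v) ^ α) ^ (1 / α)`, this `J` equals `exp (((α - 1) / α) I_α)`.

To replace `I_α(W, Ŵ)` by `I_α(W, X)` one uses data processing, which comes from the variational
formula `∫ p ^ α q ^ (1 - α) = inf_u (α ∫ u ^ (α - 1) dP + (1 - α) ∫ u ^ α dQ)`, attained at
`u = p / q`: test functions on the target of a map pull back to its source. Taking the identity map
shows that the dominating measure does not matter, so that `D_α(P ‖ P_W ⊗ Q)` can be computed with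
densities relative to the product of the marginals of `P`.
-/

namespace BayesFramework

section ExtendedPowers

theorem antitone_ennreal_rpow_of_nonpos {s : ℝ} (hs : s ≤ 0) :
    Antitone fun x : ℝ≥0∞ => x ^ s := by
  intro x y hxy
  simpa only [ENNReal.rpow_neg, inv_inv] using
    ENNReal.inv_le_inv.2 (ENNReal.rpow_le_rpow hxy (neg_nonneg.2 hs))

theorem tendsto_ennreal_rpow {ι : Type*} {l : Filter ι} {u : ι → ℝ≥0∞} {v : ι → ℝ}
    {x : ℝ≥0∞} {y : ℝ} (hu : Tendsto u l (𝓝 x)) (hv : Tendsto v l (𝓝 y))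
    (h : y ≠ 0 ∨ (x ≠ 0 ∧ x ≠ ∞)) : Tendsto (fun i => u i ^ v i) l (𝓝 (x ^ y)) := by
  simp only [ENNReal.rpow_eq_exp_mul_log]
  have hlog : Tendsto (fun i => ENNReal.log (u i)) l (𝓝 (ENNReal.log x)) :=
    (ENNReal.continuous_log.tendsto x).comp hu
  refine (ENNReal.continuous_exp.tendsto _).comp (EReal.Tendsto.mul (EReal.tendsto_coe.2 hv) hlog
    ?_ ?_ (Or.inl (EReal.coe_ne_bot y)) (Or.inl (EReal.coe_ne_top y)))
  · exact h.imp (by simp) (by simp +contextual)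
  · exact h.imp (by simp) (by simp +contextual)

end ExtendedPowers

section ReverseHolder

variable {Ω : Type*} [MeasurableSpace Ω] {μ : Measure Ω} {f g : Ω → ℝ≥0∞} {α β : ℝ}

theorem rpow_eq_mul_rpow_mul_rpow_conj {x y : ℝ≥0∞} (h0 : 0 < α) (h1 : α < 1) (hx : x ≠ 0)
    (hxy : x * y ≠ ∞) : y ^ α = (x * y) ^ α * (x ^ (α / (α - 1))) ^ (1 - α) := by
  have hexp : (x ^ (α / (α - 1))) ^ (1 - α) = (x ^ α)⁻¹ := by
    rw [← ENNReal.rpow_mul, ← ENNReal.rpow_neg]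
    congr 1
    have : α - 1 ≠ 0 := by linarith
    field_simp
    ring
  rw [hexp, ENNReal.mul_rpow_of_nonneg _ _ h0.le]
  rcases eq_or_ne x ∞ with rfl | hx_top
  · have hy : y = 0 := by
      by_contra hy
      exact hxy (ENNReal.top_mul hy)
    simp [hy, ENNReal.zero_rpow_of_pos h0]
  · rw [mul_right_comm, ENNReal.mul_inv_cancel (by simp [hx, hx_top]) (by simp [hx, hx_top]),
      one_mul]

theorem lintegral_rpow_le_lintegral_mul_rpow (hf : AEMeasurable f μ) (hg : AEMeasurable g μ)
    (h0 : 0 < α) (h1 : α < 1) (hfg_top : ∫⁻ x, g x * f x ∂μ ≠ ∞)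
    (hg_top : ∫⁻ x, g x ^ (α / (α - 1)) ∂μ ≠ ∞) :
    ∫⁻ x, f x ^ α ∂μ ≤
      (∫⁻ x, g x * f x ∂μ) ^ α * (∫⁻ x, g x ^ (α / (α - 1)) ∂μ) ^ (1 - α) := by
  have hβ : α / (α - 1) < 0 := div_neg_of_pos_of_neg h0 (sub_neg.2 h1)
  have hg_ne_zero : ∀ᵐ x ∂μ, g x ≠ 0 := by
    filter_upwards [ae_lt_top' (hg.pow_const _) hg_top] with x hx hgx
    simp [hgx, ENNReal.zero_rpow_of_neg hβ] at hx
  calc ∫⁻ x, f x ^ α ∂μ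
      = ∫⁻ x, (g x * f x) ^ α * (g x ^ (α / (α - 1))) ^ (1 - α) ∂μ := by
        refine lintegral_congr_ae ?_
        filter_upwards [ae_lt_top' (hg.mul hf) hfg_top, hg_ne_zero] with x hfgx hgx
        exact rpow_eq_mul_rpow_mul_rpow_conj h0 h1 hgx hfgx.ne
    _ ≤ _ := ENNReal.lintegral_mul_norm_pow_le (hg.mul hf) (hg.pow_const _) h0.le
        (sub_nonneg.2 h1.le) (add_sub_cancel _ _)

theorem eq_div_sub_one_of_one_div_add_one_div_eq_one (h0 : α ≠ 0) (h1 : α ≠ 1)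
    (hαβ : 1 / α + 1 / β = 1) : β = α / (α - 1) := by
  have hinv : β⁻¹ = (α - 1) / α := by
    rw [← one_div, eq_sub_of_add_eq' hαβ]
    field_simp
  rw [← inv_inv β, hinv, inv_div]

theorem eLpNorm'_mul_eLpNorm'_le_lintegral_mul_of_pos (hf : AEMeasurable f μ)
    (hg : AEMeasurable g μ) (h0 : 0 < α) (h1 : α < 1) (hαβ : 1 / α + 1 / β = 1) :
    eLpNorm' g β μ * eLpNorm' f α μ ≤ ∫⁻ x, g x * f x ∂μ := by
  obtain rfl := eq_div_sub_one_of_one_div_add_one_div_eq_one h0.ne' h1.ne hαβ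
  have hexp : 1 / (α / (α - 1)) = -((1 - α) * (1 / α)) := by
    rw [one_div_div, ← neg_sub, neg_div, mul_one_div]
  simp only [eLpNorm'_eq_lintegral_enorm, enorm_eq_self, hexp, ENNReal.rpow_neg]
  set G := ∫⁻ x, g x ^ (α / (α - 1)) ∂μ
  by_cases hfg_top : ∫⁻ x, g x * f x ∂μ = ∞
  · simp [hfg_top]
  by_cases hG : G = ∞
  · simp [hG, mul_pos (sub_pos.2 h1) (inv_pos.2 h0)]
  calc (G ^ ((1 - α) * (1 / α)))⁻¹ * (∫⁻ x, f x ^ α ∂μ) ^ (1 / α)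
      ≤ (G ^ ((1 - α) * (1 / α)))⁻¹ * ((∫⁻ x, g x * f x ∂μ) ^ α * G ^ (1 - α)) ^ (1 / α) := by
        gcongr
        exact lintegral_rpow_le_lintegral_mul_rpow hf hg h0 h1 hfg_top hG
    _ = (∫⁻ x, g x * f x ∂μ) *
          (G ^ ((1 - α) * (1 / α)) * (G ^ ((1 - α) * (1 / α)))⁻¹) := by
        rw [ENNReal.mul_rpow_of_nonneg _ _ (by positivity), ← ENNReal.rpow_mul,
          ← ENNReal.rpow_mul, mul_one_div_cancel h0.ne', ENNReal.rpow_one, mul_comm, mul_assoc]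
    _ ≤ ∫⁻ x, g x * f x ∂μ := mul_le_of_le_one_right' (ENNReal.mul_inv_le_one _)

theorem eLpNorm'_mul_eLpNorm'_le_lintegral_mul (hf : AEMeasurable f μ) (hg : AEMeasurable g μ)
    (h0 : α ≠ 0) (h1 : α < 1) (hαβ : 1 / α + 1 / β = 1) :
    eLpNorm' g β μ * eLpNorm' f α μ ≤ ∫⁻ x, g x * f x ∂μ := by
  rcases h0.lt_or_gt with hα | hα
  · have hβ : β = α / (α - 1) :=
      eq_div_sub_one_of_one_div_add_one_div_eq_one h0 h1.ne hαβ
    have hβ0 : 0 < β := hβ ▸ div_pos_of_neg_of_neg hα (by linarith)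
    have hβ1 : β < 1 := by
      rw [hβ, div_lt_one_of_neg (by linarith)]
      linarith
    simpa only [mul_comm] using
      eLpNorm'_mul_eLpNorm'_le_lintegral_mul_of_pos hg hf hβ0 hβ1 (by rwa [add_comm])
  · exact eLpNorm'_mul_eLpNorm'_le_lintegral_mul_of_pos hf hg hα h1 hαβ

end ReverseHolder

section NestedNorm

variable {𝒲 𝒱 : Type*} [MeasurableSpace 𝒲] [MeasurableSpace 𝒱] {μ : Measure 𝒲} {ν : Measure 𝒱}
  {f g : 𝒲 → 𝒱 → ℝ≥0∞} {α β α' β' : ℝ}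

theorem nestedNorm_eq_eLpNorm' (p p' : ℝ) :
    nestedNorm μ ν p p' g = eLpNorm' (fun v => eLpNorm' (fun w => g w v) p μ) p' ν := by
  simp only [nestedNorm, eLpNorm'_eq_lintegral_enorm, enorm_eq_self, ← ENNReal.rpow_mul,
    one_div_mul_eq_div]

theorem measurable_eLpNorm'_left [SFinite μ] (hg : Measurable (Function.uncurry g)) (p : ℝ) :
    Measurable fun v => eLpNorm' (fun w => g w v) p μ :=
  (Measurable.lintegral_prod_left' (hg.pow_const p)).pow_const _

theorem nestedNorm_mul_nestedNorm_le_lintegral_mul [SFinite μ] [SFinite ν]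
    (hf : Measurable (Function.uncurry f)) (hg : Measurable (Function.uncurry g))
    (hα0 : α ≠ 0) (hα : α < 1) (hα'0 : α' ≠ 0) (hα' : α' < 1)
    (h : 1 / α + 1 / β = 1) (h' : 1 / α' + 1 / β' = 1) :
    nestedNorm μ ν β β' g * nestedNorm μ ν α α' f ≤
      ∫⁻ z, f z.1 z.2 * g z.1 z.2 ∂(μ.prod ν) := by
  rw [nestedNorm_eq_eLpNorm', nestedNorm_eq_eLpNorm']
  calc _ ≤ ∫⁻ v, eLpNorm' (fun w => g w v) β μ * eLpNorm' (fun w => f w v) α μ ∂ν :=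
        eLpNorm'_mul_eLpNorm'_le_lintegral_mul (measurable_eLpNorm'_left hf α).aemeasurable
          (measurable_eLpNorm'_left hg β).aemeasurable hα'0 hα' h'
    _ ≤ ∫⁻ v, ∫⁻ w, g w v * f w v ∂μ ∂ν :=
        lintegral_mono fun v => eLpNorm'_mul_eLpNorm'_le_lintegral_mul
          (hf.comp measurable_prodMk_right).aemeasurable
          (hg.comp measurable_prodMk_right).aemeasurable hα0 hα h
    _ = ∫⁻ z, f z.1 z.2 * g z.1 z.2 ∂(μ.prod ν) := by
        simp only [mul_comm (g _ _)]
        exact (lintegral_prod_symm' _ (hf.mul hg)).symm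

theorem lintegral_rnDeriv_mul_le {Ω : Type*} [MeasurableSpace Ω] (P μ : Measure Ω)
    {h : Ω → ℝ≥0∞} (hh : Measurable h) : ∫⁻ x, P.rnDeriv μ x * h x ∂μ ≤ ∫⁻ x, h x ∂P :=
  (lintegral_withDensity_eq_lintegral_mul μ (P.measurable_rnDeriv μ) hh).symm.trans_le
    (lintegral_mono' (P.withDensity_rnDeriv_le μ) le_rfl)

theorem reverseHolderBound_le_lintegral (P : Measure (𝒲 × 𝒱)) [IsFiniteMeasure P]
    {ℓ : 𝒲 → 𝒱 → ℝ≥0} (hℓ : Measurable (Function.uncurry ℓ))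
    (hα0 : α ≠ 0) (hα : α < 1) (hα'0 : α' ≠ 0) (hα' : α' < 1)
    (h : 1 / α + 1 / β = 1) (h' : 1 / α' + 1 / β' = 1) :
    reverseHolderBound P ℓ α β α' β' ≤ ∫⁻ z, (ℓ z.1 z.2 : ℝ≥0∞) ∂P :=
  (nestedNorm_mul_nestedNorm_le_lintegral_mul
    (f := fun w v => P.rnDeriv (P.fst.prod P.snd) (w, v)) (P.measurable_rnDeriv _)
    (g := fun w v => (ℓ w v : ℝ≥0∞)) hℓ.coe_nnreal_ennreal hα0 hα hα'0 hα' h h').trans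
    (lintegral_rnDeriv_mul_le P _ hℓ.coe_nnreal_ennreal)

end NestedNorm

section Limits

variable {Ω : Type*} [MeasurableSpace Ω] {ν : Measure Ω} {f : Ω → ℝ≥0∞}

theorem mul_measure_lt_rpow_le_eLpNorm' (hf : AEMeasurable f ν) (c : ℝ≥0∞) {p : ℝ} (hp : 0 < p) :
    c * ν {x | c < f x} ^ (1 / p) ≤ eLpNorm' f p ν := by
  calc c * ν {x | c < f x} ^ (1 / p) = (c ^ p * ν {x | c < f x}) ^ (1 / p) := by
        rw [ENNReal.mul_rpow_of_nonneg _ _ (by positivity), ← ENNReal.rpow_mul,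
          mul_one_div_cancel hp.ne', ENNReal.rpow_one]
    _ ≤ (c ^ p * ν {x | c ^ p ≤ f x ^ p}) ^ (1 / p) := by
        gcongr with x
        exact fun h => ENNReal.rpow_le_rpow h.le hp.le
    _ ≤ eLpNorm' f p ν := by
        rw [eLpNorm'_eq_lintegral_enorm]
        gcongr
        exact mul_meas_ge_le_lintegral₀ (hf.pow_const p) _

theorem tendsto_mul_rpow_one_div_atTop (c : ℝ≥0∞) {m : ℝ≥0∞} (h0 : m ≠ 0) (htop : m ≠ ∞) :
    Tendsto (fun p : ℝ => c * m ^ (1 / p)) atTop (𝓝 c) := by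
  have hexp : Tendsto (fun p : ℝ => 1 / p) atTop (𝓝 0) := by
    simpa only [one_div] using tendsto_inv_atTop_zero (𝕜 := ℝ)
  have hm : Tendsto (fun p : ℝ => m ^ (1 / p)) atTop (𝓝 1) := by
    simpa only [ENNReal.rpow_zero] using
      tendsto_ennreal_rpow tendsto_const_nhds hexp (Or.inr ⟨h0, htop⟩)
  simpa only [mul_one] using ENNReal.Tendsto.const_mul hm (Or.inl one_ne_zero)

theorem eLpNorm'_neg_exponent (f : Ω → ℝ≥0∞) (p : ℝ) :
    eLpNorm' f (-p) ν = (eLpNorm' f⁻¹ p ν)⁻¹ := by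
  simp only [eLpNorm'_eq_lintegral_enorm, enorm_eq_self, Pi.inv_apply, ENNReal.inv_rpow,
    ENNReal.rpow_neg, one_div, inv_neg]

variable [IsFiniteMeasure ν]

theorem tendsto_eLpNorm'_atTop (hf : AEMeasurable f ν) :
    Tendsto (fun p : ℝ => eLpNorm' f p ν) atTop (𝓝 (essSup f ν)) := by
  rcases eq_or_ne ν 0 with rfl | hν
  · rw [essSup_measure_zero]
    refine tendsto_const_nhds.congr' ?_
    filter_upwards [eventually_gt_atTop 0] with p hp
    exact (eLpNorm'_measure_zero_of_pos hp).symm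
  refine tendsto_order.2 ⟨fun d hd => ?_, fun d hd => ?_⟩
  · obtain ⟨c, hdc, hc⟩ := exists_between hd
    have hpos : ν {x | c < f x} ≠ 0 := fun h => hc.not_ge (essSup_le_of_ae_le c (by
      simpa [Filter.EventuallyLE, ae_iff] using h))
    have hlim := tendsto_mul_rpow_one_div_atTop c hpos (measure_ne_top _ _)
    filter_upwards [hlim.eventually (lt_mem_nhds hdc), eventually_gt_atTop 0] with p hp hp0
    exact hp.trans_le (mul_measure_lt_rpow_le_eLpNorm' hf c hp0)
  · have hlim := tendsto_mul_rpow_one_div_atTop (essSup f ν)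
      (Measure.measure_univ_ne_zero.2 hν) (measure_ne_top _ _)
    filter_upwards [hlim.eventually (gt_mem_nhds hd), eventually_gt_atTop 0] with p hp hp0
    exact (eLpNorm'_le_eLpNormEssSup_mul_rpow_measure_univ hp0).trans_lt hp

theorem tendsto_eLpNorm'_atBot (hf : AEMeasurable f ν) :
    Tendsto (fun p : ℝ => eLpNorm' f p ν) atBot (𝓝 (essInf f ν)) := by
  have hinv : essInf f ν = (essSup f⁻¹ ν)⁻¹ := by
    rw [← inv_inv (essInf f ν)]
    exact congrArg _ (OrderIso.essInf_apply f ν OrderIso.invENNReal)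
  rw [hinv]
  refine ((tendsto_eLpNorm'_atTop hf.inv).comp tendsto_neg_atBot_atTop).inv.congr fun p => ?_
  rw [Function.comp_apply, ← eLpNorm'_neg_exponent, neg_neg]

theorem tendsto_eLpNorm'_nhdsLT (hf : Measurable f) {p : ℝ} (hp : 0 < p)
    (hfin : ∫⁻ x, f x ^ p ∂ν ≠ ∞) :
    Tendsto (fun q : ℝ => eLpNorm' f q ν) (𝓝[<] p) (𝓝 (eLpNorm' f p ν)) := by
  have hq : Tendsto (fun q : ℝ => q) (𝓝[<] p) (𝓝 p) := tendsto_id.mono_left nhdsWithin_le_nhds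
  have hbound : ∀ᶠ q : ℝ in 𝓝[<] p, ∀ᵐ x ∂ν, f x ^ q ≤ 1 + f x ^ p := by
    filter_upwards [self_mem_nhdsWithin, hq.eventually (lt_mem_nhds hp)] with q hqp hq0
    refine ae_of_all _ fun x => ?_
    rcases le_total (f x) 1 with hx | hx
    · exact (ENNReal.rpow_le_one hx hq0.le).trans le_self_add
    · exact (ENNReal.rpow_le_rpow_of_exponent_le hx (le_of_lt hqp)).trans le_add_self
  have hint : Tendsto (fun q : ℝ => ∫⁻ x, f x ^ q ∂ν) (𝓝[<] p) (𝓝 (∫⁻ x, f x ^ p ∂ν)) := by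
    refine tendsto_lintegral_filter_of_dominated_convergence _
      (Eventually.of_forall fun q => hf.pow_const q) hbound ?_ (ae_of_all _ fun x => ?_)
    · rw [lintegral_add_left measurable_const, lintegral_one]
      exact ENNReal.add_ne_top.2 ⟨measure_ne_top _ _, hfin⟩
    · exact tendsto_ennreal_rpow tendsto_const_nhds hq (Or.inl hp.ne')
  simp only [eLpNorm'_eq_lintegral_enorm, enorm_eq_self, one_div]
  exact tendsto_ennreal_rpow hint (hq.inv₀ hp.ne') (Or.inl (inv_ne_zero hp.ne'))

theorem tendsto_div_sub_one_nhdsLT_one_atBot :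
    Tendsto (fun a : ℝ => a / (a - 1)) (𝓝[<] 1) atBot := by
  have hsub : Tendsto (fun a : ℝ => a - 1) (𝓝[<] 1) (𝓝[<] 0) := by
    refine tendsto_nhdsWithin_iff.2 ⟨?_, ?_⟩
    · have h : Tendsto (fun a : ℝ => a - 1) (𝓝 1) (𝓝 (1 - 1)) := tendsto_id.sub_const 1
      exact (sub_self (1 : ℝ) ▸ h).mono_left nhdsWithin_le_nhds
    · filter_upwards [self_mem_nhdsWithin] with a ha using sub_neg.2 (Set.mem_Iio.1 ha)
  exact (tendsto_id.mono_left nhdsWithin_le_nhds).pos_mul_atBot one_pos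
    (tendsto_inv_nhdsLT_zero.comp hsub)

end Limits

section DensityNorm

variable {𝒲 𝒱 : Type*} [MeasurableSpace 𝒲] [MeasurableSpace 𝒱]

/-- The `L^α` (pseudo-)norm in `w ∼ P.fst` of the density at `(w, v)` of the joint law `P` with
respect to the product of its marginals, as a function of `v`. -/
noncomputable def densityNorm (α : ℝ) (P : Measure (𝒲 × 𝒱)) (v : 𝒱) : ℝ≥0∞ :=
  eLpNorm' (fun w => P.rnDeriv (P.fst.prod P.snd) (w, v)) α P.fst

/-- The integral of `densityNorm α P` over the second marginal. It is the closed form of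
`exp (((α - 1) / α) I_α)`, see `exp_mul_sibsonInfo`. -/
noncomputable def sibsonIntegral (α : ℝ) (P : Measure (𝒲 × 𝒱)) : ℝ≥0∞ :=
  ∫⁻ v, densityNorm α P v ∂P.snd

variable (P : Measure (𝒲 × 𝒱)) {α : ℝ}

theorem densityNorm_rpow (h0 : α ≠ 0) (v : 𝒱) :
    densityNorm α P v ^ α = ∫⁻ w, P.rnDeriv (P.fst.prod P.snd) (w, v) ^ α ∂P.fst := by
  rw [densityNorm, eLpNorm'_eq_lintegral_enorm, ← ENNReal.rpow_mul, one_div_mul_cancel h0,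
    ENNReal.rpow_one]
  simp only [enorm_eq_self]

variable [IsFiniteMeasure P]

theorem measurable_densityNorm (α : ℝ) : Measurable (densityNorm α P) :=
  measurable_eLpNorm'_left (g := fun w v => P.rnDeriv (P.fst.prod P.snd) (w, v))
    (P.measurable_rnDeriv _) α

theorem sibsonIntegral_ne_top (h0 : 0 < α) (h1 : α ≤ 1) : sibsonIntegral α P ≠ ∞ := by
  have hf : Measurable (P.rnDeriv (P.fst.prod P.snd)) := P.measurable_rnDeriv _
  have hmass : P.fst Set.univ ^ (1 / α - 1 / 1) ≠ ∞ :=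
    ENNReal.rpow_ne_top_of_nonneg (by rw [sub_nonneg]; gcongr) (measure_ne_top _ _)
  refine ne_top_of_le_ne_top (ENNReal.mul_ne_top (measure_ne_top P Set.univ) hmass) ?_
  calc sibsonIntegral α P
      ≤ ∫⁻ v, (∫⁻ w, P.rnDeriv (P.fst.prod P.snd) (w, v) ∂P.fst) *
          P.fst Set.univ ^ (1 / α - 1 / 1) ∂P.snd := by
        refine lintegral_mono fun v => ?_
        simpa only [eLpNorm'_eq_lintegral_enorm, enorm_eq_self, ENNReal.rpow_one, div_one,
          densityNorm, Function.comp_apply] using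
          eLpNorm'_le_eLpNorm'_mul_rpow_measure_univ (μ := P.fst) h0 h1
            (hf.comp (measurable_prodMk_right (y := v))).aestronglyMeasurable
    _ = (∫⁻ z, P.rnDeriv (P.fst.prod P.snd) z ∂(P.fst.prod P.snd)) *
          P.fst Set.univ ^ (1 / α - 1 / 1) := by
        rw [lintegral_mul_const _ hf.lintegral_prod_left', lintegral_prod_symm' _ hf]
    _ ≤ P Set.univ * P.fst Set.univ ^ (1 / α - 1 / 1) := by
        gcongr
        exact Measure.lintegral_rnDeriv_le

theorem tendsto_eLpNorm'_densityNorm (h0 : 0 < α) (h1 : α ≤ 1) :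
    Tendsto (fun a : ℝ => eLpNorm' (densityNorm α P) a P.snd) (𝓝[<] 1)
      (𝓝 (sibsonIntegral α P)) := by
  have hJ : eLpNorm' (densityNorm α P) 1 P.snd = sibsonIntegral α P := by
    simp only [eLpNorm'_eq_lintegral_enorm, enorm_eq_self, ENNReal.rpow_one, div_one,
      sibsonIntegral]
  rw [← hJ]
  refine tendsto_eLpNorm'_nhdsLT (measurable_densityNorm P α) one_pos ?_
  simpa only [ENNReal.rpow_one, sibsonIntegral] using sibsonIntegral_ne_top P h0 h1

theorem eventually_eLpNorm'_densityNorm_eq_zero (hJ : sibsonIntegral α P = 0) :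
    ∀ᶠ a : ℝ in 𝓝[<] 1, eLpNorm' (densityNorm α P) a P.snd = 0 := by
  filter_upwards [nhdsWithin_le_nhds (lt_mem_nhds one_pos)] with a ha
  exact eLpNorm'_eq_zero_of_ae_zero ha ((lintegral_eq_zero_iff (measurable_densityNorm P α)).1 hJ)

theorem tendsto_reverseHolderBound {ℓ : 𝒲 → 𝒱 → ℝ≥0} (hℓ : Measurable (Function.uncurry ℓ))
    (h0 : 0 < α) (h1 : α ≤ 1) (β : ℝ) :
    Tendsto (fun a : ℝ => reverseHolderBound P ℓ α β a (a / (a - 1))) (𝓝[<] 1)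
      (𝓝 (essInfNorm P.fst P.snd β ℓ * sibsonIntegral α P)) := by
  set L : 𝒱 → ℝ≥0∞ := fun v => eLpNorm' (fun w => (ℓ w v : ℝ≥0∞)) β P.fst
  have hL : Measurable L :=
    measurable_eLpNorm'_left (g := fun w v => (ℓ w v : ℝ≥0∞)) hℓ.coe_nnreal_ennreal β
  have hbound (a : ℝ) : reverseHolderBound P ℓ α β a (a / (a - 1)) =
      eLpNorm' L (a / (a - 1)) P.snd * eLpNorm' (densityNorm α P) a P.snd := by
    rw [reverseHolderBound, nestedNorm_eq_eLpNorm', nestedNorm_eq_eLpNorm']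
    rfl
  have hLess : Tendsto (fun a : ℝ => eLpNorm' L (a / (a - 1)) P.snd) (𝓝[<] 1)
      (𝓝 (essInfNorm P.fst P.snd β ℓ)) :=
    (tendsto_eLpNorm'_atBot hL.aemeasurable).comp tendsto_div_sub_one_nhdsLT_one_atBot
  simp only [hbound]
  rcases eq_or_ne (sibsonIntegral α P) 0 with hJ | hJ
  · rw [hJ, mul_zero]
    refine tendsto_const_nhds.congr' ?_
    filter_upwards [eventually_eLpNorm'_densityNorm_eq_zero P hJ] with a ha
    rw [ha, mul_zero]
  · exact ENNReal.Tendsto.mul hLess (Or.inr (sibsonIntegral_ne_top P h0 h1))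
      (tendsto_eLpNorm'_densityNorm P h0 h1) (Or.inl hJ)

end DensityNorm

/-- The Hellinger integral `∫ p ^ α q ^ (1 - α) dμ`, where `p` and `q` are the densities of the
absolutely continuous parts of `P` and `Q` with respect to `μ`. -/
noncomputable def hellingerIntegral {Ω : Type*} [MeasurableSpace Ω] (α : ℝ) (P Q μ : Measure Ω) :
    ℝ≥0∞ :=
  ∫⁻ x, P.rnDeriv μ x ^ α * Q.rnDeriv μ x ^ (1 - α) ∂μ

section WeightedYoung

variable {α : ℝ} {p q : ℝ≥0∞}

theorem rpow_mul_rpow_le_ofReal_mul_add (h0 : 0 < α) (h1 : α < 1) (a b : ℝ≥0∞) :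
    a ^ α * b ^ (1 - α) ≤ ENNReal.ofReal α * a + ENNReal.ofReal (1 - α) * b := by
  have h1α : 0 < 1 - α := sub_pos.2 h1
  have hconj : (1 / α).HolderConjugate (1 / (1 - α)) :=
    Real.holderConjugate_iff.2 ⟨(one_lt_div h0).2 h1, by simp⟩
  have hweight {t : ℝ} (ht : 0 < t) (c : ℝ≥0∞) :
      (c ^ t) ^ (1 / t) / ENNReal.ofReal (1 / t) = ENNReal.ofReal t * c := by
    rw [← ENNReal.rpow_mul, mul_one_div_cancel ht.ne', ENNReal.rpow_one, one_div,
      ENNReal.ofReal_inv_of_pos ht, div_eq_mul_inv, inv_inv, mul_comm]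
  simpa only [hweight h0, hweight h1α] using
    ENNReal.young_inequality (a ^ α) (b ^ (1 - α)) hconj

theorem rpow_mul_rpow_le_weighted (h0 : 0 < α) (h1 : α < 1) (p q u : ℝ≥0∞) :
    p ^ α * q ^ (1 - α) ≤
      ENNReal.ofReal α * (p * u ^ (α - 1)) + ENNReal.ofReal (1 - α) * (q * u ^ α) := by
  have h1α : 0 < 1 - α := sub_pos.2 h1
  rcases eq_or_ne u 0 with rfl | hu0
  · rcases eq_or_ne p 0 with rfl | hp
    · simp [ENNReal.zero_rpow_of_pos h0]
    · simp [ENNReal.zero_rpow_of_neg (sub_neg.2 h1), ENNReal.mul_top, hp, h0]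
  rcases eq_or_ne u ∞ with rfl | hu_top
  · rcases eq_or_ne q 0 with rfl | hq
    · simp [ENNReal.zero_rpow_of_pos h1α]
    · simp [ENNReal.top_rpow_of_pos h0, ENNReal.mul_top, hq, h1]
  calc p ^ α * q ^ (1 - α) = (p * u ^ (α - 1)) ^ α * (q * u ^ α) ^ (1 - α) := by
        rw [ENNReal.mul_rpow_of_nonneg _ _ h0.le, ENNReal.mul_rpow_of_nonneg _ _ h1α.le,
          mul_mul_mul_comm, ← ENNReal.rpow_mul, ← ENNReal.rpow_mul,
          ← ENNReal.rpow_add _ _ hu0 hu_top, show (α - 1) * α + α * (1 - α) = 0 by ring,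
          ENNReal.rpow_zero, mul_one]
    _ ≤ _ := rpow_mul_rpow_le_ofReal_mul_add h0 h1 _ _

theorem mul_div_rpow (h0 : 0 < α) (h1 : α < 1) (hq : q ≠ ∞) :
    q * (p / q) ^ α = p ^ α * q ^ (1 - α) := by
  rcases eq_or_ne q 0 with rfl | hq0
  · simp [ENNReal.zero_rpow_of_pos (sub_pos.2 h1)]
  calc q * (p / q) ^ α = p ^ α * (q ^ (1 : ℝ) * q ^ (-α)) := by
        rw [ENNReal.div_rpow_of_nonneg _ _ h0.le, div_eq_mul_inv, ← ENNReal.rpow_neg,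
          mul_left_comm, ENNReal.rpow_one]
    _ = p ^ α * q ^ (1 - α) := by rw [← ENNReal.rpow_add _ _ hq0 hq, ← sub_eq_add_neg]

theorem mul_div_rpow_sub_one (h0 : 0 < α) (h1 : α < 1) (hp : p ≠ ∞) (hq : q ≠ ∞) :
    p * (p / q) ^ (α - 1) = p ^ α * q ^ (1 - α) := by
  rcases eq_or_ne p 0 with rfl | hp0
  · simp [ENNReal.zero_rpow_of_pos h0]
  rcases eq_or_ne q 0 with rfl | hq0
  · simp [ENNReal.div_zero hp0, ENNReal.top_rpow_of_neg (sub_neg.2 h1),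
      ENNReal.zero_rpow_of_pos (sub_pos.2 h1)]
  calc p * (p / q) ^ (α - 1) = p * (q / p) ^ (1 - α) := by
        rw [← neg_sub 1 α, ENNReal.rpow_neg, ← ENNReal.inv_rpow,
          ENNReal.inv_div (Or.inl hq) (Or.inl hq0)]
    _ = p ^ α * q ^ (1 - α) := by
        rw [mul_div_rpow (sub_pos.2 h1) (sub_lt_self 1 h0) hp, sub_sub_cancel, mul_comm]

end WeightedYoung

section Hellinger

variable {Ω Ω' : Type*} [MeasurableSpace Ω] [MeasurableSpace Ω'] {α : ℝ}
  {P P' Q Q' μ : Measure Ω}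

theorem hellingerIntegral_swap (α : ℝ) (P Q μ : Measure Ω) :
    hellingerIntegral (1 - α) Q P μ = hellingerIntegral α P Q μ := by
  simp only [hellingerIntegral, sub_sub_cancel, mul_comm]

theorem hellingerIntegral_le_lintegral (h0 : 0 < α) (h1 : α < 1) (P Q μ : Measure Ω)
    {u : Ω → ℝ≥0∞} (hu : Measurable u) :
    hellingerIntegral α P Q μ ≤ ENNReal.ofReal α * ∫⁻ x, u x ^ (α - 1) ∂P +
      ENNReal.ofReal (1 - α) * ∫⁻ x, u x ^ α ∂Q := by
  have hp : Measurable fun x => P.rnDeriv μ x * u x ^ (α - 1) :=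
    (P.measurable_rnDeriv μ).mul (hu.pow_const _)
  have hq : Measurable fun x => Q.rnDeriv μ x * u x ^ α :=
    (Q.measurable_rnDeriv μ).mul (hu.pow_const _)
  calc hellingerIntegral α P Q μ
      ≤ ∫⁻ x, (ENNReal.ofReal α * (P.rnDeriv μ x * u x ^ (α - 1)) +
          ENNReal.ofReal (1 - α) * (Q.rnDeriv μ x * u x ^ α)) ∂μ :=
        lintegral_mono fun x => rpow_mul_rpow_le_weighted h0 h1 _ _ _
    _ = ENNReal.ofReal α * ∫⁻ x, P.rnDeriv μ x * u x ^ (α - 1) ∂μ +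
          ENNReal.ofReal (1 - α) * ∫⁻ x, Q.rnDeriv μ x * u x ^ α ∂μ := by
        rw [lintegral_add_left (hp.const_mul _), lintegral_const_mul _ hp,
          lintegral_const_mul _ hq]
    _ ≤ _ := by
        gcongr ENNReal.ofReal α * ?_ + ENNReal.ofReal (1 - α) * ?_
        exacts [lintegral_rnDeriv_mul_le P μ (hu.pow_const _),
          lintegral_rnDeriv_mul_le Q μ (hu.pow_const _)]

theorem lintegral_rnDeriv_div_rnDeriv_eq_hellingerIntegral (h0 : 0 < α) (h1 : α < 1)
    [SigmaFinite P] [SigmaFinite Q] [SigmaFinite μ] (hP : P ≪ μ) (hQ : Q ≪ μ) :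
    ENNReal.ofReal α * ∫⁻ x, (P.rnDeriv μ x / Q.rnDeriv μ x) ^ (α - 1) ∂P +
      ENNReal.ofReal (1 - α) * ∫⁻ x, (P.rnDeriv μ x / Q.rnDeriv μ x) ^ α ∂Q =
        hellingerIntegral α P Q μ := by
  have hu (s : ℝ) : AEMeasurable (fun x => (P.rnDeriv μ x / Q.rnDeriv μ x) ^ s) μ :=
    (((P.measurable_rnDeriv μ).div (Q.measurable_rnDeriv μ)).pow_const s).aemeasurable
  have hPint : ∫⁻ x, (P.rnDeriv μ x / Q.rnDeriv μ x) ^ (α - 1) ∂P =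
      hellingerIntegral α P Q μ := by
    rw [← lintegral_rnDeriv_mul hP (hu _)]
    refine lintegral_congr_ae ?_
    filter_upwards [P.rnDeriv_ne_top μ, Q.rnDeriv_ne_top μ] with x hp hq
    exact mul_div_rpow_sub_one h0 h1 hp hq
  have hQint : ∫⁻ x, (P.rnDeriv μ x / Q.rnDeriv μ x) ^ α ∂Q = hellingerIntegral α P Q μ := by
    rw [← lintegral_rnDeriv_mul hQ (hu _)]
    refine lintegral_congr_ae ?_
    filter_upwards [Q.rnDeriv_ne_top μ] with x hq
    exact mul_div_rpow h0 h1 hq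
  rw [hPint, hQint, ← add_mul, ← ENNReal.ofReal_add h0.le (sub_nonneg.2 h1.le), add_sub_cancel,
    ENNReal.ofReal_one, one_mul]

theorem hellingerIntegral_le_hellingerIntegral_map (h0 : 0 < α) (h1 : α < 1)
    [IsFiniteMeasure P] [IsFiniteMeasure Q] {T : Ω → Ω'} (hT : Measurable T) {ν : Measure Ω'}
    [SigmaFinite ν] (hP : P.map T ≪ ν) (hQ : Q.map T ≪ ν) :
    hellingerIntegral α P Q μ ≤ hellingerIntegral α (P.map T) (Q.map T) ν := by
  have hu : Measurable fun y => (P.map T).rnDeriv ν y / (Q.map T).rnDeriv ν y :=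
    ((P.map T).measurable_rnDeriv ν).div ((Q.map T).measurable_rnDeriv ν)
  rw [← lintegral_rnDeriv_div_rnDeriv_eq_hellingerIntegral h0 h1 hP hQ,
    lintegral_map (hu.pow_const _) hT, lintegral_map (hu.pow_const _) hT]
  exact hellingerIntegral_le_lintegral h0 h1 P Q μ (hu.comp hT)

theorem hellingerIntegral_eq_of_absolutelyContinuous (h0 : 0 < α) (h1 : α < 1)
    [IsFiniteMeasure P] [IsFiniteMeasure Q] [SigmaFinite μ] {ν : Measure Ω} [SigmaFinite ν]
    (hPμ : P ≪ μ) (hQμ : Q ≪ μ) (hPν : P ≪ ν) (hQν : Q ≪ ν) :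
    hellingerIntegral α P Q μ = hellingerIntegral α P Q ν := by
  refine le_antisymm ?_ ?_
  · simpa only [Measure.map_id] using hellingerIntegral_le_hellingerIntegral_map h0 h1
      (P := P) (Q := Q) (μ := μ) measurable_id (by rwa [Measure.map_id]) (by rwa [Measure.map_id])
  · simpa only [Measure.map_id] using hellingerIntegral_le_hellingerIntegral_map h0 h1
      (P := P) (Q := Q) (μ := ν) measurable_id (by rwa [Measure.map_id]) (by rwa [Measure.map_id])

theorem ae_mem_imp_rnDeriv_eq_zero (P μ : Measure Ω) {s : Set Ω} (hs : MeasurableSet s)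
    (hPs : P s = 0) : ∀ᵐ x ∂μ, x ∈ s → P.rnDeriv μ x = 0 :=
  (ae_restrict_iff' hs).1 ((lintegral_eq_zero_iff (P.measurable_rnDeriv μ)).1
    (le_antisymm ((Measure.setLIntegral_rnDeriv_le s).trans_eq hPs) zero_le))

theorem ae_rnDeriv_eq_zero_or_of_mutuallySingular (h : P ⟂ₘ Q) (μ : Measure Ω) :
    ∀ᵐ x ∂μ, P.rnDeriv μ x = 0 ∨ Q.rnDeriv μ x = 0 := by
  obtain ⟨s, hs, hPs, hQs⟩ := h
  filter_upwards [ae_mem_imp_rnDeriv_eq_zero P μ hs hPs,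
    ae_mem_imp_rnDeriv_eq_zero Q μ hs.compl hQs] with x hx hx'
  exact (em (x ∈ s)).imp hx hx'

theorem hellingerIntegral_add_left_of_mutuallySingular (h1 : α < 1) [SigmaFinite P]
    [SigmaFinite P'] [SigmaFinite μ] (hPQ : P ⟂ₘ Q) :
    hellingerIntegral α (P + P') Q μ = hellingerIntegral α P' Q μ := by
  refine lintegral_congr_ae ?_
  filter_upwards [Measure.rnDeriv_add' P P' μ,
    ae_rnDeriv_eq_zero_or_of_mutuallySingular hPQ μ] with x hadd hzero
  rcases hzero with hp | hq
  · rw [hadd, Pi.add_apply, hp, zero_add]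
  · rw [hq, ENNReal.zero_rpow_of_pos (sub_pos.2 h1), mul_zero, mul_zero]

theorem hellingerIntegral_add_right_of_mutuallySingular (h0 : 0 < α) [SigmaFinite Q]
    [SigmaFinite Q'] [SigmaFinite μ] (hQP : Q ⟂ₘ P) :
    hellingerIntegral α P (Q + Q') μ = hellingerIntegral α P Q' μ := by
  rw [← hellingerIntegral_swap, ← hellingerIntegral_swap α P Q',
    hellingerIntegral_add_left_of_mutuallySingular (sub_lt_self 1 h0) hQP]

theorem hellingerIntegral_withDensity [SigmaFinite μ] {f g : Ω → ℝ≥0∞} (hf : Measurable f)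
    (hg : Measurable g) (α : ℝ) :
    hellingerIntegral α (μ.withDensity f) (μ.withDensity g) μ =
      ∫⁻ x, f x ^ α * g x ^ (1 - α) ∂μ := by
  refine lintegral_congr_ae ?_
  filter_upwards [Measure.rnDeriv_withDensity μ hf, Measure.rnDeriv_withDensity μ hg] with x hp hq
  rw [hp, hq]

theorem hellingerIntegral_add_withDensity (h0 : 0 < α) (h1 : α < 1) [IsFiniteMeasure P]
    [IsFiniteMeasure Q] [SigmaFinite μ] {f g : Ω → ℝ≥0∞} (hf : Measurable f) (hg : Measurable g)
    (hPdef : P = P' + μ.withDensity f) (hQdef : Q = Q' + μ.withDensity g)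
    (hP' : P' ⟂ₘ Q) (hQ' : Q' ⟂ₘ P) :
    hellingerIntegral α P Q (P + Q) = ∫⁻ x, f x ^ α * g x ^ (1 - α) ∂μ := by
  have hP'_le : P' ≤ P := hPdef ▸ Measure.le_add_right le_rfl
  have hf_le : μ.withDensity f ≤ P := hPdef ▸ Measure.le_add_left le_rfl
  have hQ'_le : Q' ≤ Q := hQdef ▸ Measure.le_add_right le_rfl
  have hg_le : μ.withDensity g ≤ Q := hQdef ▸ Measure.le_add_left le_rfl
  have := isFiniteMeasure_of_le P hP'_le
  have := isFiniteMeasure_of_le P hf_le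
  have := isFiniteMeasure_of_le Q hQ'_le
  have := isFiniteMeasure_of_le Q hg_le
  calc hellingerIntegral α P Q (P + Q)
      = hellingerIntegral α (P' + μ.withDensity f) Q (P + Q) := by rw [← hPdef]
    _ = hellingerIntegral α (μ.withDensity f) (Q' + μ.withDensity g) (P + Q) := by
        rw [hellingerIntegral_add_left_of_mutuallySingular h1 hP', ← hQdef]
    _ = hellingerIntegral α (μ.withDensity f) (μ.withDensity g) (P + Q) :=
        hellingerIntegral_add_right_of_mutuallySingular h0 (hQ'.mono le_rfl hf_le)
    _ = hellingerIntegral α (μ.withDensity f) (μ.withDensity g) μ :=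
        hellingerIntegral_eq_of_absolutelyContinuous h0 h1
          (hf_le.trans (Measure.le_add_right le_rfl)).absolutelyContinuous
          (hg_le.trans (Measure.le_add_left le_rfl)).absolutelyContinuous
          (withDensity_absolutelyContinuous μ f) (withDensity_absolutelyContinuous μ g)
    _ = ∫⁻ x, f x ^ α * g x ^ (1 - α) ∂μ := hellingerIntegral_withDensity hf hg α

theorem exp_renyiDiv (α : ℝ) (P Q : Measure Ω) :
    EReal.exp (renyiDiv α P Q) = hellingerIntegral α P Q (P + Q) ^ (α - 1)⁻¹ :=
  (ENNReal.rpow_eq_exp_mul_log _ _).symm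

theorem renyiDiv_map_le (h0 : 0 < α) (h1 : α < 1) (P Q : Measure Ω) [IsFiniteMeasure P]
    [IsFiniteMeasure Q] {T : Ω → Ω'} (hT : Measurable T) :
    renyiDiv α (P.map T) (Q.map T) ≤ renyiDiv α P Q := by
  rw [← EReal.exp_le_exp_iff, exp_renyiDiv, exp_renyiDiv]
  exact antitone_ennreal_rpow_of_nonpos (inv_nonpos.2 (sub_nonpos.2 h1.le))
    (hellingerIntegral_le_hellingerIntegral_map h0 h1 hT
      (Measure.le_add_right le_rfl).absolutelyContinuous
      (Measure.le_add_left le_rfl).absolutelyContinuous)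

end Hellinger

section Sibson

variable {𝒲 𝒳 𝒱 : Type*} [MeasurableSpace 𝒲] [MeasurableSpace 𝒳] [MeasurableSpace 𝒱] {α : ℝ}

theorem fst_map_prodMap_id (P : Measure (𝒲 × 𝒳)) {φ : 𝒳 → 𝒱} (hφ : Measurable φ) :
    (P.map (Prod.map id φ)).fst = P.fst :=
  Measure.fst_map_prodMk (hφ.comp measurable_snd)

theorem sibsonInfo_map_le (h0 : 0 < α) (h1 : α < 1) (P : Measure (𝒲 × 𝒳)) [IsFiniteMeasure P]
    {φ : 𝒳 → 𝒱} (hφ : Measurable φ) :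
    sibsonInfo α (P.map (Prod.map id φ)) ≤ sibsonInfo α P := by
  refine le_iInf fun Q => iInf_le_of_le (Q.map hφ.aemeasurable) ?_
  have hprod : P.fst.prod ((Q : Measure 𝒳).map φ) =
      (P.fst.prod (Q : Measure 𝒳)).map (Prod.map id φ) := by
    rw [← Measure.map_prod_map P.fst (Q : Measure 𝒳) measurable_id hφ, Measure.map_id]
  rw [fst_map_prodMap_id P hφ, ProbabilityMeasure.toMeasure_map, hprod]
  exact renyiDiv_map_le h0 h1 P _ (measurable_id.prodMap hφ)

theorem mutuallySingular_prod_of_mutuallySingular_snd {P : Measure (𝒲 × 𝒱)} {Q : Measure 𝒱}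
    [SFinite Q] (h : Q ⟂ₘ P.snd) (μ : Measure 𝒲) : μ.prod Q ⟂ₘ P := by
  obtain ⟨s, hs, hQs, hPs⟩ := h
  refine ⟨Prod.snd ⁻¹' s, measurable_snd hs, ?_, ?_⟩
  · rw [← Set.univ_prod, Measure.prod_prod, hQs, mul_zero]
  · rwa [← Set.preimage_compl, ← Measure.snd_apply hs.compl]

theorem prod_eq_prod_singularPart_add_withDensity (μ : Measure 𝒲) [SFinite μ] (Q ν : Measure 𝒱)
    [SigmaFinite Q] [SigmaFinite ν] :
    μ.prod Q = μ.prod (Q.singularPart ν) +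
      (μ.prod ν).withDensity (fun z => Q.rnDeriv ν z.2) := by
  rw [← prod_withDensity_right (Q.measurable_rnDeriv ν), ← Measure.prod_add,
    ← Q.haveLebesgueDecomposition_add ν]

theorem hellingerIntegral_prod (h0 : 0 < α) (h1 : α < 1) (P : Measure (𝒲 × 𝒱))
    [IsFiniteMeasure P] (Q : Measure 𝒱) [IsFiniteMeasure Q] :
    hellingerIntegral α P (P.fst.prod Q) (P + P.fst.prod Q) =
      ∫⁻ v, densityNorm α P v ^ α * Q.rnDeriv P.snd v ^ (1 - α) ∂P.snd := by
  have hf : Measurable (P.rnDeriv (P.fst.prod P.snd)) := P.measurable_rnDeriv _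
  have hg : Measurable (Q.rnDeriv P.snd) := Q.measurable_rnDeriv _
  have hQ := prod_eq_prod_singularPart_add_withDensity P.fst Q P.snd
  have hQs : P.fst.prod (Q.singularPart P.snd) ⟂ₘ P :=
    mutuallySingular_prod_of_mutuallySingular_snd (Q.mutuallySingular_singularPart P.snd) P.fst
  have hPs : P.singularPart (P.fst.prod P.snd) ⟂ₘ P.fst.prod Q := by
    rw [hQ]
    exact (hQs.mono le_rfl (Measure.singularPart_le _ _)).symm.add_right
      ((P.mutuallySingular_singularPart _).mono_ac Measure.AbsolutelyContinuous.rfl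
        (withDensity_absolutelyContinuous _ _))
  calc hellingerIntegral α P (P.fst.prod Q) (P + P.fst.prod Q)
      = ∫⁻ z, P.rnDeriv (P.fst.prod P.snd) z ^ α * Q.rnDeriv P.snd z.2 ^ (1 - α)
          ∂(P.fst.prod P.snd) :=
        hellingerIntegral_add_withDensity h0 h1 hf (hg.comp measurable_snd)
          (P.haveLebesgueDecomposition_add _) hQ hPs hQs
    _ = ∫⁻ v, ∫⁻ w, P.rnDeriv (P.fst.prod P.snd) (w, v) ^ α * Q.rnDeriv P.snd v ^ (1 - α)
          ∂P.fst ∂P.snd :=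
        lintegral_prod_symm' _ ((hf.pow_const α).mul ((hg.comp measurable_snd).pow_const _))
    _ = _ := by
        refine lintegral_congr fun v => ?_
        rw [densityNorm_rpow P h0.ne']
        exact lintegral_mul_const _ ((hf.comp measurable_prodMk_right).pow_const α)

theorem lintegral_rpow_mul_rnDeriv_rpow_le {Ω : Type*} [MeasurableSpace Ω] {ν : Measure Ω}
    {N : Ω → ℝ≥0∞} (hN : AEMeasurable N ν) (h0 : 0 ≤ α) (h1 : α ≤ 1) (Q : Measure Ω) :
    ∫⁻ x, N x ^ α * Q.rnDeriv ν x ^ (1 - α) ∂ν ≤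
      (∫⁻ x, N x ∂ν) ^ α * Q Set.univ ^ (1 - α) := by
  have h1α : 0 ≤ 1 - α := sub_nonneg.2 h1
  refine (ENNReal.lintegral_mul_norm_pow_le hN (Q.measurable_rnDeriv ν).aemeasurable h0 h1α
    (add_sub_cancel _ _)).trans ?_
  gcongr
  exact Measure.lintegral_rnDeriv_le

theorem lintegral_rpow_mul_rnDeriv_withDensity_rpow {Ω : Type*} [MeasurableSpace Ω]
    {ν : Measure Ω} [SigmaFinite ν] {N : Ω → ℝ≥0∞} (hN : Measurable N) (h0 : 0 ≤ α)
    (h1 : α ≤ 1) (c : ℝ≥0∞) :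
    ∫⁻ x, N x ^ α * (ν.withDensity fun x => N x * c).rnDeriv ν x ^ (1 - α) ∂ν =
      (∫⁻ x, N x ∂ν) * c ^ (1 - α) := by
  have h1α : 0 ≤ 1 - α := sub_nonneg.2 h1
  rw [← lintegral_mul_const _ hN]
  refine lintegral_congr_ae ?_
  filter_upwards [Measure.rnDeriv_withDensity ν (hN.mul_const c)] with x hx
  rw [hx, ENNReal.mul_rpow_of_nonneg _ _ h1α, ← mul_assoc, ← ENNReal.rpow_add_of_nonneg _ _ h0 h1α,
    add_sub_cancel, ENNReal.rpow_one]

theorem exists_lintegral_rpow_mul_rnDeriv_rpow_eq {Ω : Type*} [MeasurableSpace Ω]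
    {ν : Measure Ω} [SigmaFinite ν] {N : Ω → ℝ≥0∞} (hN : Measurable N) (h0 : 0 ≤ α)
    (h1 : α ≤ 1) (hJ0 : ∫⁻ x, N x ∂ν ≠ 0) (hJ_top : ∫⁻ x, N x ∂ν ≠ ∞) :
    ∃ Q : ProbabilityMeasure Ω,
      ∫⁻ x, N x ^ α * (Q : Measure Ω).rnDeriv ν x ^ (1 - α) ∂ν = (∫⁻ x, N x ∂ν) ^ α := by
  set J := ∫⁻ x, N x ∂ν
  have hprob : IsProbabilityMeasure (ν.withDensity fun x => N x * J⁻¹) := by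
    refine ⟨?_⟩
    rw [withDensity_apply _ MeasurableSet.univ, Measure.restrict_univ, lintegral_mul_const _ hN,
      ENNReal.mul_inv_cancel hJ0 hJ_top]
  refine ⟨⟨_, hprob⟩, ?_⟩
  calc _ = J ^ (1 : ℝ) * J ^ (-(1 - α)) := by
        rw [ProbabilityMeasure.coe_mk, lintegral_rpow_mul_rnDeriv_withDensity_rpow hN h0 h1,
          ENNReal.inv_rpow, ENNReal.rpow_neg, ENNReal.rpow_one]
    _ = J ^ α := by
        rw [← ENNReal.rpow_add _ _ hJ0 hJ_top, neg_sub, add_sub_cancel]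

theorem exp_sibsonInfo (h0 : 0 < α) (h1 : α < 1) (P : Measure (𝒲 × 𝒱)) [IsFiniteMeasure P] :
    EReal.exp (sibsonInfo α P) = sibsonIntegral α P ^ (α / (α - 1)) := by
  have hneg : (α - 1)⁻¹ < 0 := inv_lt_zero.2 (sub_neg.2 h1)
  have hN : Measurable (densityNorm α P) := measurable_densityNorm P α
  have hinf : EReal.exp (sibsonInfo α P) = ⨅ Q : ProbabilityMeasure 𝒱,
      (∫⁻ v, densityNorm α P v ^ α * (Q : Measure 𝒱).rnDeriv P.snd v ^ (1 - α) ∂P.snd) ^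
        (α - 1)⁻¹ := by
    simp only [← hellingerIntegral_prod h0 h1, ← exp_renyiDiv]
    exact EReal.expOrderIso.map_iInf _
  rw [hinf, div_eq_mul_inv, ENNReal.rpow_mul]
  refine le_antisymm ?_ (le_iInf fun Q => antitone_ennreal_rpow_of_nonpos hneg.le ?_)
  · rcases eq_or_ne (sibsonIntegral α P) 0 with hJ | hJ
    · rw [hJ, ENNReal.zero_rpow_of_pos h0, ENNReal.zero_rpow_of_neg hneg]
      exact le_top
    · obtain ⟨Q, hQ⟩ := exists_lintegral_rpow_mul_rnDeriv_rpow_eq hN h0.le h1.le hJ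
        (sibsonIntegral_ne_top P h0 h1.le)
      exact iInf_le_of_le Q (congrArg (· ^ (α - 1)⁻¹) hQ).le
  · simpa only [sibsonIntegral, measure_univ, ENNReal.one_rpow, mul_one] using
      lintegral_rpow_mul_rnDeriv_rpow_le hN.aemeasurable h0.le h1.le (Q : Measure 𝒱)

theorem exp_mul_sibsonInfo (h0 : 0 < α) (h1 : α < 1) (P : Measure (𝒲 × 𝒱)) [IsFiniteMeasure P] :
    EReal.exp ((((α - 1) / α : ℝ) : EReal) * sibsonInfo α P) = sibsonIntegral α P := by
  rw [mul_comm, EReal.exp_mul, exp_sibsonInfo h0 h1, ← ENNReal.rpow_mul,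
    div_mul_div_cancel₀ (sub_ne_zero.2 h1.ne), div_self h0.ne', ENNReal.rpow_one]

theorem antitone_exp_coe_mul {c : ℝ} (hc : c ≤ 0) :
    Antitone fun x : EReal => EReal.exp ((c : EReal) * x) := by
  intro x y hxy
  simp only [mul_comm (c : EReal), EReal.exp_mul]
  exact antitone_ennreal_rpow_of_nonpos hc (EReal.exp_le_exp_iff.2 hxy)

end Sibson

section BayesRisk

variable {𝒲 𝒳 𝒱 : Type*} [MeasurableSpace 𝒲] [MeasurableSpace 𝒳] [MeasurableSpace 𝒱]
  {ℓ : 𝒲 → 𝒱 → ℝ≥0} {α β : ℝ}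

theorem essInfNorm_mul_sibsonIntegral_le_lintegral (P : Measure (𝒲 × 𝒱)) [IsFiniteMeasure P]
    (hℓ : Measurable (Function.uncurry ℓ)) (h0 : 0 < α) (h1 : α < 1) (hαβ : 1 / α + 1 / β = 1) :
    essInfNorm P.fst P.snd β ℓ * sibsonIntegral α P ≤ ∫⁻ z, (ℓ z.1 z.2 : ℝ≥0∞) ∂P := by
  refine le_of_tendsto (tendsto_reverseHolderBound P hℓ h0 h1.le β) ?_
  filter_upwards [nhdsWithin_le_nhds (lt_mem_nhds one_pos), self_mem_nhdsWithin] with a ha0 ha1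
  refine reverseHolderBound_le_lintegral P hℓ h0.ne' h1 ha0.ne' ha1 hαβ ?_
  rw [one_div_div, ← add_div, add_sub_cancel, div_self ha0.ne']

theorem essInfNorm_mul_exp_sibsonInfo_le_lintegral_map (P : Measure (𝒲 × 𝒳)) [IsFiniteMeasure P]
    (hℓ : Measurable (Function.uncurry ℓ)) (h0 : 0 < α) (h1 : α < 1) (hαβ : 1 / α + 1 / β = 1)
    {φ : 𝒳 → 𝒱} (hφ : Measurable φ) :
    essInfNorm P.fst (P.map (Prod.map id φ)).snd β ℓ *
        EReal.exp ((((α - 1) / α : ℝ) : EReal) * sibsonInfo α P) ≤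
      ∫⁻ z, (ℓ z.1 z.2 : ℝ≥0∞) ∂(P.map (Prod.map id φ)) := by
  have hc : (α - 1) / α ≤ 0 := div_nonpos_of_nonpos_of_nonneg (sub_nonpos.2 h1.le) h0.le
  refine le_trans ?_ (essInfNorm_mul_sibsonIntegral_le_lintegral _ hℓ h0 h1 hαβ)
  rw [fst_map_prodMap_id P hφ, ← exp_mul_sibsonInfo h0 h1]
  gcongr essInfNorm _ _ _ _ * ?_
  exact antitone_exp_coe_mul hc (sibsonInfo_map_le h0 h1 P hφ)

end BayesRisk

end BayesFramework

theorem mainTheorem10_general {𝒲 𝒳 𝒱 : Type*}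
    [MeasurableSpace 𝒲] [MeasurableSpace 𝒳] [MeasurableSpace 𝒱]
    (P : Measure (𝒲 × 𝒳)) [IsFiniteMeasure P]
    (ℓ : 𝒲 → 𝒱 → ℝ≥0) (hℓ : Measurable (Function.uncurry ℓ)) :
    (∀ φ : 𝒳 → 𝒱, Measurable φ → ∀ α β α' β' : ℝ,
      α < 1 → α ≠ 0 → α' < 1 → α' ≠ 0 → 1 / α + 1 / β = 1 → 1 / α' + 1 / β' = 1 →
      BayesFramework.reverseHolderBound (P.map (Prod.map id φ)) ℓ α β α' β' ≤
        ∫⁻ z, (ℓ z.1 z.2 : ℝ≥0∞) ∂(P.map (Prod.map id φ))) ∧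
    (∀ α β : ℝ, 0 < α → α < 1 → 1 / α + 1 / β = 1 →
      (∀ φ : 𝒳 → 𝒱, Measurable φ →
        Tendsto (fun α' : ℝ => BayesFramework.reverseHolderBound
            (P.map (Prod.map id φ)) ℓ α β α' (α' / (α' - 1)))
          (𝓝[<] 1)
          (𝓝 (BayesFramework.essInfNorm P.fst (P.map (Prod.map id φ)).snd β ℓ *
            EReal.exp ((((α - 1) / α : ℝ) : EReal) *
              BayesFramework.sibsonInfo α (P.map (Prod.map id φ)))))) ∧
      (∀ φ : 𝒳 → 𝒱, Measurable φ →
        BayesFramework.essInfNorm P.fst (P.map (Prod.map id φ)).snd β ℓ *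
            EReal.exp ((((α - 1) / α : ℝ) : EReal) * BayesFramework.sibsonInfo α P) ≤
          ∫⁻ z, (ℓ z.1 z.2 : ℝ≥0∞) ∂(P.map (Prod.map id φ))) ∧
      (⨅ (φ : 𝒳 → 𝒱) (_ : Measurable φ),
          BayesFramework.essInfNorm P.fst (P.map (Prod.map id φ)).snd β ℓ) *
          EReal.exp ((((α - 1) / α : ℝ) : EReal) * BayesFramework.sibsonInfo α P) ≤
        ⨅ (φ : 𝒳 → 𝒱) (_ : Measurable φ),
          ∫⁻ z, (ℓ z.1 z.2 : ℝ≥0∞) ∂(P.map (Prod.map id φ))) := by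
  refine ⟨fun φ _ α β α' β' hα hα0 hα' hα'0 h h' =>
    BayesFramework.reverseHolderBound_le_lintegral _ hℓ hα0 hα hα'0 hα' h h',
    fun α β h0 h1 hαβ => ?_⟩
  have hbound (φ : 𝒳 → 𝒱) (hφ : Measurable φ) :=
    BayesFramework.essInfNorm_mul_exp_sibsonInfo_le_lintegral_map P hℓ h0 h1 hαβ hφ
  refine ⟨fun φ hφ => ?_, hbound, le_iInf₂ fun φ hφ => ?_⟩
  · rw [← BayesFramework.fst_map_prodMap_id P hφ, BayesFramework.exp_mul_sibsonInfo h0 h1]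
    exact BayesFramework.tendsto_reverseHolderBound _ hℓ h0 h1.le β
  · exact (mul_le_mul_left (iInf₂_le φ hφ) _).trans (hbound φ hφ)

theorem mainTheorem10 {𝒲 𝒳 𝒱 : Type*}
    [MeasurableSpace 𝒲] [MeasurableSpace 𝒳] [MeasurableSpace 𝒱]
    (PW : Measure 𝒲) [IsProbabilityMeasure PW]
    (K : Kernel 𝒲 𝒳) [IsMarkovKernel K]
    (ℓ : 𝒲 → 𝒱 → ℝ≥0) (hℓ : Measurable (Function.uncurry ℓ)) :
    -- the nested-norm bound, for every estimator and all admissible exponents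
    (∀ φ : 𝒳 → 𝒱, Measurable φ → ∀ α β α' β' : ℝ,
      α < 1 → α ≠ 0 → α' < 1 → α' ≠ 0 → 1 / α + 1 / β = 1 → 1 / α' + 1 / β' = 1 →
      BayesFramework.reverseHolderBound (BayesFramework.estimatorLaw PW K φ) ℓ α β α' β' ≤
        BayesFramework.expectedLoss PW K ℓ φ) ∧
    (∀ α β : ℝ, 0 < α → α < 1 → 1 / α + 1 / β = 1 →
      -- the limit `α' → 1⁻` (with `β' = α' / (α' - 1) → -∞`) of the nested-norm bound
      (∀ φ : 𝒳 → 𝒱, Measurable φ →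
        Tendsto (fun α' : ℝ => BayesFramework.reverseHolderBound
            (BayesFramework.estimatorLaw PW K φ) ℓ α β α' (α' / (α' - 1)))
          (𝓝[<] 1)
          (𝓝 (BayesFramework.essInfNorm PW (BayesFramework.estimatorLaw PW K φ).snd β ℓ *
            EReal.exp ((((α - 1) / α : ℝ) : EReal) *
              BayesFramework.sibsonInfo α (BayesFramework.estimatorLaw PW K φ))))) ∧
      -- the bound through `I_α(W, X)`, for every estimator
      (∀ φ : 𝒳 → 𝒱, Measurable φ →
        BayesFramework.essInfNorm PW (BayesFramework.estimatorLaw PW K φ).snd β ℓ *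
            EReal.exp ((((α - 1) / α : ℝ) : EReal) * BayesFramework.sibsonInfo α (PW ⊗ₘ K)) ≤
          BayesFramework.expectedLoss PW K ℓ φ) ∧
      -- the lower bound on the Bayes risk
      (⨅ (φ : 𝒳 → 𝒱) (_ : Measurable φ),
          BayesFramework.essInfNorm PW (BayesFramework.estimatorLaw PW K φ).snd β ℓ) *
          EReal.exp ((((α - 1) / α : ℝ) : EReal) * BayesFramework.sibsonInfo α (PW ⊗ₘ K)) ≤
        BayesFramework.bayesRisk PW K ℓ) := by
  have h := mainTheorem10_general (PW ⊗ₘ K) ℓ hℓ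
  rwa [Measure.fst_compProd] at h
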